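/- **Setting.** Fix an order of smoothness $n\in\{1,2,\dots,\infty,\omega\}$. Let $D\subset\mathbb R^3$ be a domain (non-empty, open, connected) of parameters $k=(k^1,k^2,k^3)$, and consider maps $x=x(k)\in\mathbb R^3$ on $D$ (they describe stationary ideal incompressible MHD flows with constant total pressure; for fixed $k^3$ the image is a Maxwellian surface). Functions below are of class $C^n$ on the ranges of their arguments (of class $C^{n+1}$ for $\eta$ in (2) and for $\alpha,\beta,\gamma$ in (6); no separate smoothness is required of $\nu$ in (4) and of $\alpha$ in (F), which are expressed through derivatives of $\tau$). A lower index $i$ means $\partial/\partial k^i$, a prime means $d/dk^3$, upper indices are Cartesian components, $e^1,e^2,e^3$ is the standard basis, and $\tau,\tau^i,u,v,\varphi$ (unless another argument is shown) are functions of $(k^2,k^3)$. Write $\dfrac{\partial(f,g)}{\partial(k^2,k^3)}=f_2g_3-g_2f_3$. **Canonical solutions.** 1. $x=k^1e^1+\tau$ with $\dfrac{\partial(\tau^2,\tau^3)}{\partial(k^2,k^3)}=1$. 2. (cylindrical form) $x=k^1\eta(k^3)+u\,\eta'(k^3)+v\,\eta(k^3)+\delta(k^3)$ with $\tfrac12\,\eta\cdot(\eta'\times\eta'')\,u^2+\eta\cdot(\eta'\times\delta')\,u=k^2$.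 3. $x=\bigl(k^1+F(\tau^3)\bigr)e^1+\bigl(g(k^1)+\tau^2\bigr)e^2+\tau^3e^3$ with $\dfrac{\partial(\tau^2,\tau^3)}{\partial(k^2,k^3)}=1$. 4. $x=\bigl(f(\lambda)+\tau^1\bigr)e^1+\bigl(g(\lambda)+\tau^2\bigr)e^2+\tau^3e^3$, where $\lambda=\lambda(k^1,k^3)$ takes values in an open interval on which $f$ and $g$ are defined, $g(\lambda)=f(\lambda)\,\nu(k^3)+k^1$, $\dfrac{\partial(\tau^1,\tau^3)}{\partial(k^2,k^3)}=-1$ and $\dfrac{\partial(\tau^2,\tau^3)}{\partial(k^2,k^3)}=-\nu(k^3)$. 5. $x=\bigl(u^1(k^1)+\tau^1\bigr)e^1+\bigl(u^2(k^1)+\tau^2\bigr)e^2+k^1e^3$ with $\dfrac{\partial(\tau^1,\tau^2)}{\partial(k^2,k^3)}=1$. 6. $x=\bigl(u^1(\lambda)+\tau^1\bigr)e^1+\bigl(u^2(\lambda)+\tau^2\bigr)e^2+\bigl(S(\lambda)+\alpha\tau^1+\beta\tau^2+\gamma\bigr)e^3$, where $u^1,u^2,S$ are linearly independent functions on an open interval,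 $\alpha,\beta,\gamma$ are functions of $k^3$ with $(\alpha')^2+(\beta')^2\ne0$, $\lambda=\lambda(k^1,k^3)$ satisfies $\alpha u^1(\lambda)+\beta u^2(\lambda)+k^1=S(\lambda)$, $$\tau^1=\beta'\varphi-\frac{\alpha'\gamma'}{(\alpha')^2+(\beta')^2},\qquad \tau^2=-\alpha'\varphi-\frac{\beta'\gamma'}{(\alpha')^2+(\beta')^2},$$ and $\varphi(k^2,k^3)$ satisfies $$\frac{\alpha'\beta''-\beta'\alpha''}{2}\,\varphi^2-\Bigl(\gamma''-\frac{\gamma'(\alpha'\alpha''+\beta'\beta'')}{(\alpha')^2+(\beta')^2}\Bigr)\varphi=k^2 .$$ **The family (F) of solutions whose Maxwellian surfaces have a common directing curve.** These are the maps $$x=\sigma\bigl(\lambda(k^1,k^3)\bigr)+\tau(k^2,k^3),\qquad \sigma\bigl(\lambda(k^1,k^3)\bigr)\cdot\alpha=k^1,\qquad \tau_2\times\tau_3=\alpha,$$ where $\sigma$ is a vector function on an open interval that contains the values of $\lambda$, and $\alpha=\alpha(k^3)$, except that a component of $\alpha$ may depend on $(k^2,k^3)$ if the same component of $\sigma$ vanishes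 identically. **Equivalence transformations** are the changes of parameters $\tilde k=(\varphi(k^3)k^1,\;k^2/\varphi(k^3),\;k^3)$ with $\varphi\neq0$, and $\tilde k=(k^1+\psi(k^3),\;k^2+\chi(k^3),\;k^3)$, with $\varphi,\psi,\chi$ of class $C^n$. **Theorem.** Every canonical solution 1–6 is a member of the family (F) or has the cylindrical form 2. Consequently every map that is obtained from a canonical solution by equivalence transformations is obtained by equivalence transformations from a member of (F) or from a solution of the form 2. -/

import Mathlib

open scoped Matrix

noncomputable section

namespace ConstPressureMHD

/-- Vectors of `ℝ³` in Cartesian components; the components `1, 2, 3` are the indices `0, 1, 2`. -/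
abbrev Vec3 : Type := Fin 3 → ℝ

/-- A vector function `x = x(k¹, k², k³)` on a domain (a non-empty connected open set) of the
parameters `k = (k¹, k², k³)`. Values outside the domain are irrelevant. -/
structure Flow where
  dom : Set (ℝ × ℝ × ℝ)
  isOpen : IsOpen dom
  isConnected : IsConnected dom
  pos : ℝ × ℝ × ℝ → Vec3

namespace Flow

/-- Values taken by `k¹`. -/
def dom1 (X : Flow) : Set ℝ := (fun k : ℝ × ℝ × ℝ => k.1) '' X.dom

/-- Values taken by `k³`. -/
def dom3 (X : Flow) : Set ℝ := (fun k : ℝ × ℝ × ℝ => k.2.2) '' X.dom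

/-- Values taken by `(k¹, k³)`. -/
def dom13 (X : Flow) : Set (ℝ × ℝ) := (fun k : ℝ × ℝ × ℝ => (k.1, k.2.2)) '' X.dom

/-- Values taken by `(k², k³)`. -/
def dom23 (X : Flow) : Set (ℝ × ℝ) := (fun k : ℝ × ℝ × ℝ => k.2) '' X.dom

end Flow

/-- Partial derivative in the first of two variables. -/
def dFst {E : Type*} [NormedAddCommGroup E] [NormedSpace ℝ E] (f : ℝ × ℝ → E) (p : ℝ × ℝ) : E :=
  deriv (fun t => f (t, p.2)) p.1

/-- Partial derivative in the second of two variables. -/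
def dSnd {E : Type*} [NormedAddCommGroup E] [NormedSpace ℝ E] (f : ℝ × ℝ → E) (p : ℝ × ℝ) : E :=
  deriv (fun t => f (p.1, t)) p.2

/-- For functions of `(k², k³)`: the determinant with rows `(f₂, g₂)` and `(f₃, g₃)`. -/
def jac (f g : ℝ × ℝ → ℝ) (p : ℝ × ℝ) : ℝ :=
  dFst f p * dSnd g p - dFst g p * dSnd f p

/-! The canonical solutions. Throughout, `n` is the order of smoothness. -/

/-- Straight generatrix of constant direction:
`x = k¹ e¹ + τ(k², k³)`, the Jacobian of `(τ², τ³)` being `1`. -/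
def StraightConst (n : WithTop ℕ∞) (X : Flow) : Prop :=
  ∃ τ : ℝ × ℝ → Vec3,
    ContDiffOn ℝ n τ X.dom23 ∧
    (∀ p ∈ X.dom23, jac (fun q => τ q 1) (fun q => τ q 2) p = 1) ∧
    ∀ k ∈ X.dom, X.pos k = ![k.1, 0, 0] + τ k.2

/-- The cylindrical form: `x = k¹ η(k³) + u(k², k³) η'(k³) + v(k², k³) η(k³) + δ(k³)` with
`(η · (η' × η'') / 2) u² + (η · (η' × δ')) u = k²`. -/
def Cylindrical (n : WithTop ℕ∞) (X : Flow) : Prop :=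
  ∃ (η δ : ℝ → Vec3) (u v : ℝ × ℝ → ℝ),
    ContDiffOn ℝ (n + 1) η X.dom3 ∧ ContDiffOn ℝ n δ X.dom3 ∧
    ContDiffOn ℝ n u X.dom23 ∧ ContDiffOn ℝ n v X.dom23 ∧
    (∀ p ∈ X.dom23,
      (η p.2 ⬝ᵥ (deriv η p.2 ⨯₃ deriv (deriv η) p.2)) / 2 * u p ^ 2
        + (η p.2 ⬝ᵥ (deriv η p.2 ⨯₃ deriv δ p.2)) * u p = p.1) ∧
    ∀ k ∈ X.dom, X.pos k =
      k.1 • η k.2.2 + u k.2 • deriv η k.2.2 + v k.2 • η k.2.2 + δ k.2.2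

/-- Planar generatrix, first form:
`x = (k¹ + F(τ³)) e¹ + (g(k¹) + τ²) e² + τ³ e³`, the Jacobian of `(τ², τ³)` being `1`. -/
def PlanarFirst (n : WithTop ℕ∞) (X : Flow) : Prop :=
  ∃ (K : Set ℝ) (F g : ℝ → ℝ) (τ2 τ3 : ℝ × ℝ → ℝ),
    IsOpen K ∧ Set.MapsTo τ3 X.dom23 K ∧ ContDiffOn ℝ n F K ∧ ContDiffOn ℝ n g X.dom1 ∧
    ContDiffOn ℝ n τ2 X.dom23 ∧ ContDiffOn ℝ n τ3 X.dom23 ∧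
    (∀ p ∈ X.dom23, jac τ2 τ3 p = 1) ∧
    ∀ k ∈ X.dom, X.pos k = ![k.1 + F (τ3 k.2), g k.1 + τ2 k.2, τ3 k.2]

/-- Planar generatrix, second form: `x = (f(λ) + τ¹) e¹ + (g(λ) + τ²) e² + τ³ e³`, where
`λ(k¹, k³)` satisfies `g(λ) = f(λ) ν(k³) + k¹` and the Jacobians of `(τ¹, τ³)` and `(τ², τ³)` are
`-1` and `-ν(k³)`. (The smoothness of `ν` follows from that of `τ`.) -/
def PlanarSecond (n : WithTop ℕ∞) (X : Flow) : Prop :=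
  ∃ (J : Set ℝ) (f g ν : ℝ → ℝ) (lam : ℝ × ℝ → ℝ) (τ1 τ2 τ3 : ℝ × ℝ → ℝ),
    IsOpen J ∧ IsConnected J ∧ Set.MapsTo lam X.dom13 J ∧
    ContDiffOn ℝ n f J ∧ ContDiffOn ℝ n g J ∧ ContDiffOn ℝ n lam X.dom13 ∧
    ContDiffOn ℝ n τ1 X.dom23 ∧ ContDiffOn ℝ n τ2 X.dom23 ∧ ContDiffOn ℝ n τ3 X.dom23 ∧
    (∀ p ∈ X.dom13, g (lam p) = f (lam p) * ν p.2 + p.1) ∧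
    (∀ p ∈ X.dom23, jac τ1 τ3 p = -1 ∧ jac τ2 τ3 p = -ν p.2) ∧
    ∀ k ∈ X.dom, X.pos k =
      ![f (lam (k.1, k.2.2)) + τ1 k.2, g (lam (k.1, k.2.2)) + τ2 k.2, τ3 k.2]

/-- Planar generatrix, third form:
`x = (u¹(k¹) + τ¹) e¹ + (u²(k¹) + τ²) e² + k¹ e³`, the Jacobian of `(τ¹, τ²)` being `1`. -/
def PlanarThird (n : WithTop ℕ∞) (X : Flow) : Prop :=
  ∃ (u1 u2 : ℝ → ℝ) (τ1 τ2 : ℝ × ℝ → ℝ),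
    ContDiffOn ℝ n u1 X.dom1 ∧ ContDiffOn ℝ n u2 X.dom1 ∧
    ContDiffOn ℝ n τ1 X.dom23 ∧ ContDiffOn ℝ n τ2 X.dom23 ∧
    (∀ p ∈ X.dom23, jac τ1 τ2 p = 1) ∧
    ∀ k ∈ X.dom, X.pos k = ![u1 k.1 + τ1 k.2, u2 k.1 + τ2 k.2, k.1]

/-- Spatial generatrix:
`x = (u¹(λ) + τ¹) e¹ + (u²(λ) + τ²) e² + (S(λ) + α τ¹ + β τ² + γ) e³`, where
`α, β, γ` depend on `k³`, the functions `u¹, u², S` are linearly independent, `λ(k¹, k³)` satisfies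
`α u¹(λ) + β u²(λ) + k¹ = S(λ)`, and `τ¹, τ²` are expressed through a function `φ(k², k³)` that
satisfies a quadratic equation. -/
def Spatial (n : WithTop ℕ∞) (X : Flow) : Prop :=
  ∃ (J : Set ℝ) (u1 u2 S : ℝ → ℝ) (lam : ℝ × ℝ → ℝ) (α β γ : ℝ → ℝ) (φ τ1 τ2 : ℝ × ℝ → ℝ),
    IsOpen J ∧ IsConnected J ∧ Set.MapsTo lam X.dom13 J ∧
    ContDiffOn ℝ n u1 J ∧ ContDiffOn ℝ n u2 J ∧ ContDiffOn ℝ n S J ∧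
    LinearIndependent ℝ ![J.domRestrict u1, J.domRestrict u2, J.domRestrict S] ∧
    ContDiffOn ℝ n lam X.dom13 ∧
    ContDiffOn ℝ (n + 1) α X.dom3 ∧ ContDiffOn ℝ (n + 1) β X.dom3 ∧
    ContDiffOn ℝ (n + 1) γ X.dom3 ∧ ContDiffOn ℝ n φ X.dom23 ∧
    (∀ t ∈ X.dom3, deriv α t ^ 2 + deriv β t ^ 2 ≠ 0) ∧
    (∀ p ∈ X.dom13, α p.2 * u1 (lam p) + β p.2 * u2 (lam p) + p.1 = S (lam p)) ∧
    (∀ p ∈ X.dom23,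
      τ1 p = deriv β p.2 * φ p
        - deriv α p.2 * deriv γ p.2 / (deriv α p.2 ^ 2 + deriv β p.2 ^ 2) ∧
      τ2 p = -deriv α p.2 * φ p
        - deriv β p.2 * deriv γ p.2 / (deriv α p.2 ^ 2 + deriv β p.2 ^ 2) ∧
      (deriv α p.2 * deriv (deriv β) p.2 - deriv β p.2 * deriv (deriv α) p.2) / 2 * φ p ^ 2
        - (deriv (deriv γ) p.2
            - deriv γ p.2 * (deriv α p.2 * deriv (deriv α) p.2
                + deriv β p.2 * deriv (deriv β) p.2)
              / (deriv α p.2 ^ 2 + deriv β p.2 ^ 2)) * φ p = p.1) ∧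
    ∀ k ∈ X.dom, X.pos k =
      ![u1 (lam (k.1, k.2.2)) + τ1 k.2,
        u2 (lam (k.1, k.2.2)) + τ2 k.2,
        S (lam (k.1, k.2.2)) + α k.2.2 * τ1 k.2 + β k.2.2 * τ2 k.2 + γ k.2.2]

/-- The list of canonical solutions. -/
def Canonical (n : WithTop ℕ∞) (X : Flow) : Prop :=
  StraightConst n X ∨ Cylindrical n X ∨ PlanarFirst n X ∨ PlanarSecond n X ∨ PlanarThird n X ∨
    Spatial n X

/-- Maxwellian surfaces with a common directing curve `σ`:
`x = σ(λ(k¹, k³)) + τ(k², k³)`, `σ(λ(k¹, k³)) · α = k¹`, `τ₂ × τ₃ = α`. A component of `α` is a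
function of `k³` alone, except that it may depend on `(k², k³)` if the same component of
`σ` is identically zero. (The smoothness of `α` follows from that of `τ`.) -/
def CommonDirectrix (n : WithTop ℕ∞) (X : Flow) : Prop :=
  ∃ (J : Set ℝ) (σ : ℝ → Vec3) (lam : ℝ × ℝ → ℝ) (τ α : ℝ × ℝ → Vec3),
    IsOpen J ∧ IsConnected J ∧ Set.MapsTo lam X.dom13 J ∧
    ContDiffOn ℝ n σ J ∧ ContDiffOn ℝ n lam X.dom13 ∧ ContDiffOn ℝ n τ X.dom23 ∧
    (∀ i : Fin 3, (∀ s ∈ J, σ s i = 0) ∨ ∃ a : ℝ → ℝ, ∀ p ∈ X.dom23, α p i = a p.2) ∧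
    (∀ k ∈ X.dom, σ (lam (k.1, k.2.2)) ⬝ᵥ α k.2 = k.1) ∧
    (∀ p ∈ X.dom23, dFst τ p ⨯₃ dSnd τ p = α p) ∧
    ∀ k ∈ X.dom, X.pos k = σ (lam (k.1, k.2.2)) + τ k.2

/-! Equivalence transformations. -/

/-- `Y` is `X` in the parameters `φ(k³) k¹, k² / φ(k³), k³`. -/
def Rescaled (n : WithTop ℕ∞) (X Y : Flow) : Prop :=
  ∃ φ : ℝ → ℝ, ContDiffOn ℝ n φ X.dom3 ∧ (∀ t ∈ X.dom3, φ t ≠ 0) ∧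
    Y.dom = (fun k : ℝ × ℝ × ℝ => (φ k.2.2 * k.1, k.2.1 / φ k.2.2, k.2.2)) '' X.dom ∧
    ∀ k ∈ X.dom, Y.pos (φ k.2.2 * k.1, k.2.1 / φ k.2.2, k.2.2) = X.pos k

/-- `Y` is `X` in the parameters `k¹ + ψ(k³), k² + χ(k³), k³`. -/
def Shifted (n : WithTop ℕ∞) (X Y : Flow) : Prop :=
  ∃ ψ χ : ℝ → ℝ, ContDiffOn ℝ n ψ X.dom3 ∧ ContDiffOn ℝ n χ X.dom3 ∧
    Y.dom = (fun k : ℝ × ℝ × ℝ => (k.1 + ψ k.2.2, k.2.1 + χ k.2.2, k.2.2)) '' X.dom ∧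
    ∀ k ∈ X.dom, Y.pos (k.1 + ψ k.2.2, k.2.1 + χ k.2.2, k.2.2) = X.pos k

/-- Equivalence generated by the two kinds of transformations. -/
def Equivalent (n : WithTop ℕ∞) : Flow → Flow → Prop :=
  Relation.EqvGen (fun X Y => Rescaled n X Y ∨ Shifted n X Y)

end ConstPressureMHD

end

open scoped Matrix

namespace ConstPressureMHD

namespace Flow

/-! Each canonical map other than the cylindrical one already has the shape `σ(λ) + τ`, in the same
parameters. It remains to compute `τ₂ × τ₃`, whose components are Jacobians of pairs of components
of `τ` (`crossProduct_partials`). The Jacobian conditions of the planar and straight forms prescribe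
exactly those components that meet a nonzero component of `σ`, and the equation `σ · α = k¹` is then
the equation for `λ`, or trivial when `λ = k¹`. Only the spatial form needs work. There `τ` lies in
the plane `x³ = α x¹ + β x² + γ`, and the formulas for `τ¹, τ²` encode `α'τ¹ + β'τ² + γ' = 0`, so
the plane may be differentiated as if its coefficients were constant. The `k²`-derivative of the
quadratic equation for `φ` says that the Jacobian of `(τ¹, τ²)` is `1`. Together these give `τ₂ × τ₃
= (-α, -β, 1)`. -/

theorem isOpen_dom23 (X : Flow) : IsOpen X.dom23 := isOpenMap_snd _ X.isOpen

theorem isOpen_dom1 (X : Flow) : IsOpen X.dom1 := isOpenMap_fst _ X.isOpen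

theorem isConnected_dom1 (X : Flow) : IsConnected X.dom1 :=
  X.isConnected.image _ continuous_fst.continuousOn

theorem isOpen_dom3 (X : Flow) : IsOpen X.dom3 :=
  (isOpenMap_snd.comp isOpenMap_snd) _ X.isOpen

theorem snd_mem_dom3 {X : Flow} {p : ℝ × ℝ} (hp : p ∈ X.dom23) : p.2 ∈ X.dom3 := by
  obtain ⟨k, hk, rfl⟩ := hp
  exact ⟨k, hk, rfl⟩

theorem mem_dom23 {X : Flow} {k : ℝ × ℝ × ℝ} (hk : k ∈ X.dom) : k.2 ∈ X.dom23 := ⟨k, hk, rfl⟩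

theorem mem_dom13 {X : Flow} {k : ℝ × ℝ × ℝ} (hk : k ∈ X.dom) : (k.1, k.2.2) ∈ X.dom13 :=
  ⟨k, hk, rfl⟩

end Flow

/-! ### Partial derivatives and Jacobians -/

section Partials

variable {E : Type*} [NormedAddCommGroup E] [NormedSpace ℝ E]

theorem hasDerivAt_dFst {f : ℝ × ℝ → E} {p : ℝ × ℝ} (hf : DifferentiableAt ℝ f p) :
    HasDerivAt (fun t => f (t, p.2)) (dFst f p) p.1 :=
  (DifferentiableAt.comp p.1 (f := fun t : ℝ => (t, p.2)) (g := f) hf (by fun_prop)).hasDerivAt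

theorem hasDerivAt_dSnd {f : ℝ × ℝ → E} {p : ℝ × ℝ} (hf : DifferentiableAt ℝ f p) :
    HasDerivAt (fun t => f (p.1, t)) (dSnd f p) p.2 :=
  (DifferentiableAt.comp p.2 (f := fun t : ℝ => (p.1, t)) (g := f) hf (by fun_prop)).hasDerivAt

theorem dFst_apply {f : ℝ × ℝ → Vec3} {p : ℝ × ℝ} (hf : DifferentiableAt ℝ f p) (i : Fin 3) :
    dFst f p i = dFst (fun q => f q i) p :=
  (hasDerivAt_pi.1 (hasDerivAt_dFst hf) i).deriv.symm

theorem dSnd_apply {f : ℝ × ℝ → Vec3} {p : ℝ × ℝ} (hf : DifferentiableAt ℝ f p) (i : Fin 3) :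
    dSnd f p i = dSnd (fun q => f q i) p :=
  (hasDerivAt_pi.1 (hasDerivAt_dSnd hf) i).deriv.symm

/-- The components of `τ₂ × τ₃` are Jacobians of pairs of components of `τ`. -/
theorem crossProduct_partials {τ : ℝ × ℝ → Vec3} {p : ℝ × ℝ} (hτ : DifferentiableAt ℝ τ p) :
    dFst τ p ⨯₃ dSnd τ p =
      ![jac (fun q => τ q 1) (fun q => τ q 2) p, jac (fun q => τ q 2) (fun q => τ q 0) p,
        jac (fun q => τ q 0) (fun q => τ q 1) p] := by
  rw [cross_apply]
  simp only [dFst_apply hτ, dSnd_apply hτ, jac]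

theorem jac_swap (f g : ℝ × ℝ → ℝ) (p : ℝ × ℝ) : jac g f p = -jac f g p := by
  unfold jac; ring

/-- By the chain rule the two gradients are parallel. -/
theorem jac_self_comp {F : ℝ → ℝ} {f : ℝ × ℝ → ℝ} {p : ℝ × ℝ} (hF : DifferentiableAt ℝ F (f p))
    (hf : DifferentiableAt ℝ f p) : jac f (fun q => F (f q)) p = 0 := by
  have h1 : dFst (fun q => F (f q)) p = deriv F (f p) * dFst f p :=
    (hF.hasDerivAt.comp p.1 (hasDerivAt_dFst hf)).deriv
  have h2 : dSnd (fun q => F (f q)) p = deriv F (f p) * dSnd f p :=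
    (hF.hasDerivAt.comp p.2 (hasDerivAt_dSnd hf)).deriv
  rw [jac, h1, h2]
  ring

theorem jac_const_right (f : ℝ × ℝ → ℝ) (c : ℝ) (p : ℝ × ℝ) : jac f (fun _ => c) p = 0 := by
  simp [jac, dFst, dSnd]

theorem jac_eq_of_hasDerivAt {f g : ℝ × ℝ → ℝ} {p : ℝ × ℝ} {f2 f3 g2 g3 : ℝ}
    (hf2 : HasDerivAt (fun t => f (t, p.2)) f2 p.1) (hf3 : HasDerivAt (fun t => f (p.1, t)) f3 p.2)
    (hg2 : HasDerivAt (fun t => g (t, p.2)) g2 p.1)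
    (hg3 : HasDerivAt (fun t => g (p.1, t)) g3 p.2) : jac f g p = f2 * g3 - g2 * f3 := by
  simp only [jac, dFst, dSnd, hf2.deriv, hf3.deriv, hg2.deriv, hg3.deriv]

end Partials

theorem contDiffOn_vec3 {E : Type*} [NormedAddCommGroup E] [NormedSpace ℝ E] {n : WithTop ℕ∞}
    {s : Set E} {f g h : E → ℝ} (hf : ContDiffOn ℝ n f s) (hg : ContDiffOn ℝ n g s)
    (hh : ContDiffOn ℝ n h s) : ContDiffOn ℝ n (fun x => ![f x, g x, h x] : E → Vec3) s := by
  rw [contDiffOn_pi]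
  intro i
  fin_cases i
  · exact hf
  · exact hg
  · exact hh

theorem differentiableAt_dom23 {E : Type*} [NormedAddCommGroup E] [NormedSpace ℝ E]
    {n : WithTop ℕ∞} (hn : 1 ≤ n) {X : Flow} {f : ℝ × ℝ → E} (hf : ContDiffOn ℝ n f X.dom23)
    {p : ℝ × ℝ} (hp : p ∈ X.dom23) : DifferentiableAt ℝ f p :=
  (hf.contDiffAt (X.isOpen_dom23.mem_nhds hp)).differentiableAt (zero_lt_one.trans_le hn).ne'

variable {n : WithTop ℕ∞} {X : Flow}

/-! ### The non-cylindrical canonical solutions as members of (F) -/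

theorem StraightConst.commonDirectrix (hn : 1 ≤ n) (h : StraightConst n X) :
    CommonDirectrix n X := by
  obtain ⟨τ, hτ, hjac, hpos⟩ := h
  have hcross := fun p hp => crossProduct_partials (differentiableAt_dom23 hn hτ (p := p) hp)
  -- The last two components of `σ` vanish, so the corresponding components of `α` are free to
  -- depend on `k²`.
  refine ⟨Set.univ, fun s => ![s, 0, 0], fun q => q.1, τ, fun p => dFst τ p ⨯₃ dSnd τ p,
    isOpen_univ, isConnected_univ, fun _ _ => trivial,
    contDiffOn_vec3 contDiffOn_id contDiffOn_const contDiffOn_const, contDiff_fst.contDiffOn, hτ,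
    fun i => ?_, fun k hk => ?_, fun _ _ => rfl, hpos⟩
  · fin_cases i
    · exact .inr ⟨fun _ => 1, fun p hp => by simp [hcross p hp, hjac p hp]⟩
    · exact .inl fun s _ => by simp
    · exact .inl fun s _ => by simp
  · simp [hcross _ (Flow.mem_dom23 hk), hjac _ (Flow.mem_dom23 hk), dotProduct,
      Fin.sum_univ_three]

theorem PlanarFirst.commonDirectrix (hn : 1 ≤ n) (h : PlanarFirst n X) :
    CommonDirectrix n X := by
  obtain ⟨K, F, g, τ2, τ3, hK, hmaps, hF, hg, hτ2, hτ3, hjac, hpos⟩ := h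
  have hτ := contDiffOn_vec3 (f := fun q => F (τ3 q)) (hF.comp hτ3 hmaps) hτ2 hτ3
  have hcross := fun p hp => crossProduct_partials (differentiableAt_dom23 hn hτ (p := p) hp)
  have hzero : ∀ p ∈ X.dom23, jac τ3 (fun q => F (τ3 q)) p = 0 := fun p hp =>
    jac_self_comp ((hF.contDiffAt (hK.mem_nhds (hmaps hp))).differentiableAt
      (zero_lt_one.trans_le hn).ne') (differentiableAt_dom23 hn hτ3 hp)
  refine ⟨X.dom1, fun s => ![s, g s, 0], fun q => q.1, _, fun p => _,
    X.isOpen_dom1, X.isConnected_dom1, ?_,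
    contDiffOn_vec3 contDiffOn_id hg contDiffOn_const, contDiff_fst.contDiffOn, hτ,
    fun i => ?_, fun k hk => ?_, fun _ _ => rfl, fun k hk => ?_⟩
  · rintro _ ⟨k, hk, rfl⟩
    exact ⟨k, hk, rfl⟩
  · fin_cases i
    · exact .inr ⟨fun _ => 1, fun p hp => by simp [hcross p hp, hjac p hp]⟩
    · exact .inr ⟨fun _ => 0, fun p hp => by simp [hcross p hp, hzero p hp]⟩
    · exact .inl fun s _ => by simp
  · have hp := Flow.mem_dom23 hk
    simp [hcross _ hp, hjac _ hp, hzero _ hp, dotProduct, Fin.sum_univ_three]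
  · rw [hpos k hk]
    simp

theorem PlanarSecond.commonDirectrix (hn : 1 ≤ n) (h : PlanarSecond n X) :
    CommonDirectrix n X := by
  obtain ⟨J, f, g, ν, lam, τ1, τ2, τ3, hJ, hJc, hmaps, hf, hg, hlam, hτ1, hτ2, hτ3, hν, hjac,
    hpos⟩ := h
  have hτ := contDiffOn_vec3 hτ1 hτ2 hτ3
  have hcross := fun p hp => crossProduct_partials (differentiableAt_dom23 hn hτ (p := p) hp)
  have hone : ∀ p ∈ X.dom23, jac τ3 τ1 p = 1 := fun p hp => by
    rw [jac_swap, (hjac p hp).1, neg_neg]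
  -- Here `α = (-ν, 1, *)`, so `σ · α = k¹` reads `g(λ) - f(λ) ν = k¹`.
  refine ⟨J, fun s => ![f s, g s, 0], lam, _, fun p => _, hJ, hJc, hmaps,
    contDiffOn_vec3 hf hg contDiffOn_const, hlam, hτ,
    fun i => ?_, fun k hk => ?_, fun _ _ => rfl, fun k hk => ?_⟩
  · fin_cases i
    · exact .inr ⟨fun t => -ν t, fun p hp => by simp [hcross p hp, (hjac p hp).2]⟩
    · exact .inr ⟨fun _ => 1, fun p hp => by simp [hcross p hp, hone p hp]⟩
    · exact .inl fun s _ => by simp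
  · have hp := Flow.mem_dom23 hk
    simp [hcross _ hp, (hjac _ hp).2, hone _ hp, dotProduct, Fin.sum_univ_three,
      hν _ (Flow.mem_dom13 hk)]
  · rw [hpos k hk]
    simp

theorem PlanarThird.commonDirectrix (hn : 1 ≤ n) (h : PlanarThird n X) :
    CommonDirectrix n X := by
  obtain ⟨u1, u2, τ1, τ2, hu1, hu2, hτ1, hτ2, hjac, hpos⟩ := h
  have hτ := contDiffOn_vec3 hτ1 hτ2 (contDiffOn_const (c := (0 : ℝ)))
  have hcross : ∀ p ∈ X.dom23, _ = ![(0 : ℝ), 0, 1] := fun p hp =>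
    (crossProduct_partials (differentiableAt_dom23 hn hτ hp)).trans <| by
      simp [jac_const_right, jac_swap τ1 (fun _ => 0), hjac p hp]
  refine ⟨X.dom1, fun s => ![u1 s, u2 s, s], fun q => q.1, _, fun p => ![0, 0, 1],
    X.isOpen_dom1, X.isConnected_dom1, ?_,
    contDiffOn_vec3 hu1 hu2 contDiffOn_id, contDiff_fst.contDiffOn, hτ,
    fun i => .inr ⟨fun _ => ![(0 : ℝ), 0, 1] i, fun _ _ => rfl⟩, fun k hk => ?_, hcross,
    fun k hk => ?_⟩
  · rintro _ ⟨k, hk, rfl⟩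
    exact ⟨k, hk, rfl⟩
  · simp [dotProduct, Fin.sum_univ_three]
  · rw [hpos k hk]
    simp

theorem Spatial.commonDirectrix (hn : 1 ≤ n) (h : Spatial n X) : CommonDirectrix n X := by
  obtain ⟨J, u1, u2, S, lam, α, β, γ, φ, τ1, τ2, hJ, hJc, hmaps, hu1, hu2, hS, -, hlam, hα, hβ,
    hγ, hφ, hN, hS', hτφ, hpos⟩ := h
  have hO := X.isOpen_dom3
  have hn1 : n ≤ n + 1 := le_self_add
  have hα' := hα.deriv_of_isOpen hO le_rfl
  have hβ' := hβ.deriv_of_isOpen hO le_rfl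
  have hγ' := hγ.deriv_of_isOpen hO le_rfl
  have lift : ∀ {f : ℝ → ℝ}, ContDiffOn ℝ n f X.dom3 →
      ContDiffOn ℝ n (fun p : ℝ × ℝ => f p.2) X.dom23 := fun hf =>
    hf.comp contDiff_snd.contDiffOn fun _ hp => Flow.snd_mem_dom3 hp
  have hasDeriv : ∀ {f : ℝ → ℝ}, ContDiffOn ℝ n f X.dom3 → ∀ {t}, t ∈ X.dom3 →
      HasDerivAt f (deriv f t) t := fun hf _ ht =>
    ((hf.contDiffAt (hO.mem_nhds ht)).differentiableAt (zero_lt_one.trans_le hn).ne').hasDerivAt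
  -- Smoothness of `τ¹, τ²` is not given; it is read off from their formulas, where `α', β', γ'` are
  -- of class `C^n`.
  have hμ : ContDiffOn ℝ n (fun t => deriv γ t / (deriv α t ^ 2 + deriv β t ^ 2)) X.dom3 :=
    hγ'.div ((hα'.pow 2).add (hβ'.pow 2)) hN
  have hτ1 : ContDiffOn ℝ n τ1 X.dom23 :=
    (((lift hβ').mul hφ).sub (lift (hα'.mul hμ))).congr fun p hp => by
      rw [(hτφ p hp).1]; simp [mul_div_assoc]
  have hτ2 : ContDiffOn ℝ n τ2 X.dom23 :=
    (((lift hα').neg.mul hφ).sub (lift (hβ'.mul hμ))).congr fun p hp => by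
      rw [(hτφ p hp).2.1]; simp [mul_div_assoc]
  have hτ3 : ContDiffOn ℝ n (fun p => α p.2 * τ1 p + β p.2 * τ2 p + γ p.2) X.dom23 :=
    (((lift (hα.of_le hn1)).mul hτ1).add ((lift (hβ.of_le hn1)).mul hτ2)).add
      (lift (hγ.of_le hn1))
  have hτ := contDiffOn_vec3 hτ1 hτ2 hτ3
  have hcross : ∀ p ∈ X.dom23, _ = ![-α p.2, -β p.2, 1] := fun p hp =>
    (crossProduct_partials (differentiableAt_dom23 hn hτ hp)).trans <| by
      have ht := Flow.snd_mem_dom3 hp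
      have hNp := hN _ ht
      have dφ2 := hasDerivAt_dFst (differentiableAt_dom23 hn hφ hp)
      have dφ3 := hasDerivAt_dSnd (differentiableAt_dom23 hn hφ hp)
      have dα := hasDeriv (hα.of_le hn1) ht
      have dβ := hasDeriv (hβ.of_le hn1) ht
      have dγ := hasDeriv (hγ.of_le hn1) ht
      have dα' := hasDeriv hα' ht
      have dβ' := hasDeriv hβ' ht
      have dγ' := hasDeriv hγ' ht
      -- The formulas hold only on `X.dom23`; openness makes them hold near `p` along both
      -- coordinate lines, so they can be differentiated.
      have near2 : ∀ᶠ t in nhds p.1, (t, p.2) ∈ X.dom23 :=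
        (by fun_prop : ContinuousAt (fun t : ℝ => (t, p.2)) p.1).eventually
          (X.isOpen_dom23.mem_nhds hp)
      have near3 : ∀ᶠ t in nhds p.2, (p.1, t) ∈ X.dom23 :=
        (by fun_prop : ContinuousAt (fun t : ℝ => (p.1, t)) p.2).eventually
          (X.isOpen_dom23.mem_nhds hp)
      have dN := (dα'.pow 2).add (dβ'.pow 2)
      have dτ12 := ((dφ2.const_mul (deriv β p.2)).sub_const
        (deriv α p.2 * deriv γ p.2 / (deriv α p.2 ^ 2 + deriv β p.2 ^ 2))).congr_of_eventuallyEq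
        (near2.mono fun t h => (hτφ _ h).1)
      have dτ22 := ((dφ2.const_mul (-deriv α p.2)).sub_const
        (deriv β p.2 * deriv γ p.2 / (deriv α p.2 ^ 2 + deriv β p.2 ^ 2))).congr_of_eventuallyEq
        (near2.mono fun t h => (hτφ _ h).2.1)
      have dτ13 := ((dβ'.mul dφ3).sub ((dα'.mul dγ').div dN hNp)).congr_of_eventuallyEq
        (near3.mono fun t h => (hτφ _ h).1)
      have dτ23 := ((dα'.neg.mul dφ3).sub ((dβ'.mul dγ').div dN hNp)).congr_of_eventuallyEq
        (near3.mono fun t h => (hτφ _ h).2.1)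
      -- The quadratic expression in `φ` equals `k²`, hence its `k²`-derivative is `1`.
      have dquad := ((((dφ2.pow 2).const_mul
          ((deriv α p.2 * deriv (deriv β) p.2 - deriv β p.2 * deriv (deriv α) p.2) / 2)).sub
        (dφ2.const_mul (deriv (deriv γ) p.2
          - deriv γ p.2 * (deriv α p.2 * deriv (deriv α) p.2
            + deriv β p.2 * deriv (deriv β) p.2) / (deriv α p.2 ^ 2 + deriv β p.2 ^ 2)))).unique
        ((hasDerivAt_id p.1).congr_of_eventuallyEq (near2.mono fun t h => (hτφ _ h).2.2)))
      -- Since `τ¹₂ = β'φ₂` and `τ²₂ = -α'φ₂`, the Jacobian is `φ₂(α'τ¹₃ + β'τ²₃)`. The terms in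
      -- `φ₃` cancel, leaving the left side of `dquad`.
      have j12 : jac τ1 τ2 p = 1 := by
        rw [jac_eq_of_hasDerivAt dτ12 dτ13 dτ22 dτ23, ← dquad]
        simp
        field_simp
        ring
      have hplane : deriv α p.2 * τ1 p + deriv β p.2 * τ2 p + deriv γ p.2 = 0 := by
        rw [(hτφ p hp).1, (hτφ p hp).2.1]
        field_simp
        ring
      have d12 := hasDerivAt_dFst (differentiableAt_dom23 hn hτ1 hp)
      have d13 := hasDerivAt_dSnd (differentiableAt_dom23 hn hτ1 hp)
      have d22 := hasDerivAt_dFst (differentiableAt_dom23 hn hτ2 hp)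
      have d23 := hasDerivAt_dSnd (differentiableAt_dom23 hn hτ2 hp)
      have d32 := ((d12.const_mul (α p.2)).add (d22.const_mul (β p.2))).add_const (γ p.2)
      have d33 := ((dα.mul d13).add (dβ.mul d23)).add dγ
      -- By `hplane` the derivatives of `α, β, γ` drop out of `τ³₃`, so only `α` times the Jacobian
      -- of `(τ¹, τ²)` survives, up to sign.
      have j23 : jac τ2 (fun p => α p.2 * τ1 p + β p.2 * τ2 p + γ p.2) p = -α p.2 := by
        rw [jac_eq_of_hasDerivAt d22 d23 d32 d33]
        rw [jac] at j12
        linear_combination (-α p.2) * j12 + dFst τ2 p * hplane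
      have j31 : jac (fun p => α p.2 * τ1 p + β p.2 * τ2 p + γ p.2) τ1 p = -β p.2 := by
        rw [jac_eq_of_hasDerivAt d32 d33 d12 d13]
        rw [jac] at j12
        linear_combination (-β p.2) * j12 - dFst τ1 p * hplane
      simp [j12, j23, j31]
  refine ⟨J, fun s => ![u1 s, u2 s, S s], lam, _, fun p => ![-α p.2, -β p.2, 1], hJ, hJc, hmaps,
    contDiffOn_vec3 hu1 hu2 hS, hlam, hτ,
    fun i => .inr ⟨fun t => ![-α t, -β t, 1] i, fun _ _ => rfl⟩, fun k hk => ?_, hcross,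
    fun k hk => ?_⟩
  · have := hS' _ (Flow.mem_dom13 hk)
    simp only [dotProduct, Fin.sum_univ_three]
    simp
    linear_combination -this
  · rw [hpos k hk]
    simp
    ring

theorem Canonical.commonDirectrix_or_cylindrical (hn : 1 ≤ n) (h : Canonical n X) :
    CommonDirectrix n X ∨ Cylindrical n X := by
  rcases h with h | h | h | h | h | h
  · exact .inl (h.commonDirectrix hn)
  · exact .inr h
  all_goals exact .inl (h.commonDirectrix hn)

end ConstPressureMHD

theorem theorem3 (n : WithTop ℕ∞) (hn : 1 ≤ n) :
    (∀ X : ConstPressureMHD.Flow, ConstPressureMHD.Canonical n X →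
      ConstPressureMHD.CommonDirectrix n X ∨ ConstPressureMHD.Cylindrical n X) ∧
    (∀ X : ConstPressureMHD.Flow,
      (∃ Y, ConstPressureMHD.Canonical n Y ∧ ConstPressureMHD.Equivalent n Y X) →
      ∃ Y, ConstPressureMHD.Equivalent n Y X ∧
        (ConstPressureMHD.CommonDirectrix n Y ∨ ConstPressureMHD.Cylindrical n Y)) :=
  ⟨fun _ h => h.commonDirectrix_or_cylindrical hn,
    -- The canonical solution itself serves as the required member, with the same chain of
    -- transformations.
    fun _ ⟨Y, hY, hYX⟩ => ⟨Y, hYX, hY.commonDirectrix_or_cylindrical hn⟩⟩
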